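/- Let $Q=\{1,\dots,p\}$ and, for every $q\in Q$, let $f_q:\mathbb{R}^n\to\mathbb{R}$ be convex, let $C_q\subset\mathbb{R}^n$ be nonempty, closed and convex, and let $$M_q(x)=\partial f_q(x)+N_{C_q}(x),\qquad A_q=\arg\min_{x\in C_q} f_q(x),$$ where $\partial f_q(x)=\{y : f_q(x')\ge f_q(x)+y\cdot(x'-x)\ \forall x'\in\mathbb{R}^n\}$ is the convex subdifferential and $N_{C_q}(x)$ is the normal cone to $C_q$ at $x$, that is, $N_{C_q}(x)=\{v : v\cdot(x'-x)\le 0\ \forall x'\in C_q\}$ if $x\in C_q$ and $N_{C_q}(x)=\emptyset$ otherwise. Assume that $A=\bigcap_{q\in Q}A_q$ is nonempty. Let $\sigma:[0,\infty)\to Q$ be a switching signal, i.e. there are $0=t_0<t_1<t_2<\cdots$ such that $\sigma$ is constant on $[t_j,t_{j+1})$ for $j=0,1,2,\dots$ Let $\mu$ be Lebesgue (outer) measure on $\mathbb{R}$ and $$T_q(\sigma)=\{t\in[0,\infty) : \sigma(t)=q\},\qquad Q_\infty(\sigma)=\{q\in Q : \mu(T_q(\sigma))=\infty\},\qquad A_\infty(\sigma)=\bigcap_{q\in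 Q_\infty(\sigma)}A_q .$$ Then for every complete solution $\phi$ of the switching system $\dot x\in -M_{\sigma(t)}(x)$, i.e. every locally absolutely continuous $\phi:[0,\infty)\to\mathbb{R}^n$ with $\dot\phi(t)\in -M_{\sigma(t)}(\phi(t))$ for almost every $t\ge 0$, the limit $\lim_{t\to\infty}\phi(t)$ exists and belongs to $A_\infty(\sigma)$. -/

import Mathlib

open Set Filter Topology MeasureTheory
open scoped Pointwise RealInnerProductSpace

namespace SwitchingGradientFlow

/-- `ℝⁿ` with the Euclidean norm and inner product. -/
abbrev E (n : ℕ) : Type := EuclideanSpace ℝ (Fin n)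

/-- The subdifferential of `g : ℝⁿ → ℝ` at `x`, in the sense of convex analysis. -/
def subdifferential {n : ℕ} (g : E n → ℝ) (x : E n) : Set (E n) :=
  {y | ∀ x' : E n, g x + ⟪y, x' - x⟫ ≤ g x'}

/-- The normal cone to `D` at `x`; it is empty when `x ∉ D`. -/
def normalCone {n : ℕ} (D : Set (E n)) (x : E n) : Set (E n) :=
  {v | x ∈ D ∧ ∀ x' ∈ D, ⟪v, x' - x⟫ ≤ 0}

/-- The set-valued map `M(x) = ∂f(x) + N_C(x)` (Minkowski sum of sets). -/
def flowMap {n : ℕ} (f : E n → ℝ) (C : Set (E n)) (x : E n) : Set (E n) :=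
  subdifferential f x + normalCone C x

/-- The set of minimizers of `f` over `C`. -/
def argminOn {n : ℕ} (f : E n → ℝ) (C : Set (E n)) : Set (E n) :=
  {x | x ∈ C ∧ ∀ y ∈ C, f x ≤ f y}

/-- Switching signals with modes in `Fin p`: there is a sequence `0 = t₀ < t₁ < t₂ < …` such that
`σ` is constant on every `[tⱼ, tⱼ₊₁)`. Only the values of `σ` on `[0, ∞)` ever matter. -/
def IsSwitchingSignal {p : ℕ} (σ : ℝ → Fin p) : Prop :=
  ∃ τ : ℕ → ℝ, τ 0 = 0 ∧ StrictMono τ ∧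
    ∀ j : ℕ, ∀ t ∈ Ico (τ j) (τ (j + 1)), σ t = σ (τ j)

/-- The admissible time domains of solutions: `[0, T)`, `[0, T]` or `[0, ∞)`. -/
def IsTimeDomain (D : Set ℝ) : Prop :=
  (∃ T : ℝ, 0 < T ∧ D = Ico 0 T) ∨ (∃ T : ℝ, 0 ≤ T ∧ D = Icc 0 T) ∨ D = Ici 0

/-- Local absolute continuity on an interval `D`: absolute continuity on every compact
subinterval of `D`. -/
def LocallyAbsolutelyContinuousOn {n : ℕ} (φ : ℝ → E n) (D : Set ℝ) : Prop :=
  ∀ a ∈ D, ∀ b ∈ D, a ≤ b → AbsolutelyContinuousOnInterval φ a b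

/-- `φ`, with time domain `D`, is a solution of the switching system `ẋ ∈ -M_{σ(t)}(x)`, where
`M_q = ∂f_q + N_{C_q}`. The values of `φ` outside `D` are irrelevant. -/
def IsSolution {n p : ℕ} (f : Fin p → E n → ℝ) (C : Fin p → Set (E n)) (σ : ℝ → Fin p)
    (D : Set ℝ) (φ : ℝ → E n) : Prop :=
  IsTimeDomain D ∧ LocallyAbsolutelyContinuousOn φ D ∧
    ∀ᵐ t ∂(volume.restrict D), ∃ v : E n,
      HasDerivWithinAt φ v D t ∧ v ∈ -flowMap (f (σ t)) (C (σ t)) (φ t)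

/-- Complete solutions: those with time domain `[0, ∞)`. -/
def IsCompleteSolution {n p : ℕ} (f : Fin p → E n → ℝ) (C : Fin p → Set (E n)) (σ : ℝ → Fin p)
    (φ : ℝ → E n) : Prop :=
  IsSolution f C σ (Ici 0) φ

/-- `T_q(σ)`, the set of times in `[0, ∞)` at which the mode `q` is active. -/
def activeTimes {p : ℕ} (σ : ℝ → Fin p) (q : Fin p) : Set ℝ :=
  {t | 0 ≤ t ∧ σ t = q}

/-- `Q_∞(σ)`, the set of modes that are active for infinite total time. -/
def infiniteModes {p : ℕ} (σ : ℝ → Fin p) : Set (Fin p) :=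
  {q | volume (activeTimes σ q) = ⊤}

/-- `A = ⋂_{q ∈ Q} A_q`, the set of common minimizers. -/
def commonMinimizers {n p : ℕ} (f : Fin p → E n → ℝ) (C : Fin p → Set (E n)) : Set (E n) :=
  ⋂ q : Fin p, argminOn (f q) (C q)

/-- `A_∞(σ) = ⋂_{q ∈ Q_∞(σ)} A_q`. -/
def asymptoticMinimizers {n p : ℕ} (f : Fin p → E n → ℝ) (C : Fin p → Set (E n))
    (σ : ℝ → Fin p) : Set (E n) :=
  ⋂ q ∈ infiniteModes σ, argminOn (f q) (C q)

end SwitchingGradientFlow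

/-! Fix a common minimizer `a`. Then `V = ‖φ - a‖²` is nonincreasing, so `φ` is bounded and has a
cluster point `x₀`. Let `W = ‖φ - x₀‖²`. Modes minimized at `x₀` do not increase `W`. Near `x₀`,
every other mode decreases `V` at a uniform rate (`exists_uniform_gap`), while `W` grows at a
bounded rate since the speed is bounded (`exists_ae_norm_velocity_le`). So `W + K V` is
nonincreasing near `x₀` for a suitable `K`; as `V` converges and `W` is frequently small, `W → 0`. A
mode not minimized at the limit makes `V ≥ 0` drop at a fixed rate at almost all its late active
times, so these have finite measure. -/

/-- The squared distance to a point, along an absolutely continuous curve, is absolutely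
continuous. -/
theorem AbsolutelyContinuousOnInterval.norm_sub_sq {F : Type*} [NormedAddCommGroup F]
    [NormedSpace ℝ F] {φ : ℝ → F} {a b : ℝ} (hφ : AbsolutelyContinuousOnInterval φ a b) (x : F) :
    AbsolutelyContinuousOnInterval (fun t => ‖φ t - x‖ ^ 2) a b := by
  have h : AbsolutelyContinuousOnInterval (fun t => ‖φ t - x‖) a b := by
    refine squeeze_zero (fun t => Finset.sum_nonneg fun i _ => dist_nonneg) (fun t => ?_) hφ
    refine Finset.sum_le_sum fun i _ => ?_
    rw [Real.dist_eq, dist_eq_norm]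
    refine (abs_norm_sub_norm_le _ _).trans_eq ?_
    congr 1
    abel
  simpa only [pow_two] using h.fun_mul h

/-- An absolutely continuous function with almost everywhere nonpositive derivative does not
increase. -/
theorem AbsolutelyContinuousOnInterval.le_of_ae_deriv_nonpos {h : ℝ → ℝ} {a b : ℝ} (hab : a ≤ b)
    (hh : AbsolutelyContinuousOnInterval h a b)
    (hd : ∀ᵐ t, t ∈ Ioo a b → deriv h t ≤ 0) : h b ≤ h a := by
  have hint := hh.integral_deriv_eq_sub
  have hle : ∫ t in a..b, deriv h t ≤ 0 := by
    rw [intervalIntegral.integral_of_le hab, integral_Ioc_eq_integral_Ioo]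
    exact integral_nonpos_of_ae ((ae_restrict_iff' measurableSet_Ioo).2 hd)
  linarith

/-- A nonnegative, nonincreasing, locally absolutely continuous function decreases at a rate of at
least `c > 0` only on a set of finite measure. -/
theorem volume_setOf_le_neg_deriv_lt_top {h : ℝ → ℝ}
    (hac : ∀ T, 0 ≤ T → AbsolutelyContinuousOnInterval h 0 T)
    (hd : ∀ᵐ t, 0 < t → deriv h t ≤ 0) (h0 : ∀ t, 0 ≤ h t) {c : ℝ} (hc : 0 < c) :
    volume {t | 0 < t ∧ c ≤ -deriv h t} < ⊤ := by
  have hmeas : MeasurableSet {t : ℝ | c ≤ -deriv h t} :=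
    measurableSet_le measurable_const (measurable_deriv h).neg
  have hbound : ∀ n : ℕ, volume ({t : ℝ | c ≤ -deriv h t} ∩ Ioc 0 (n : ℝ))
      ≤ ENNReal.ofReal (h 0 / c) := by
    intro n
    have hn : (0 : ℝ) ≤ n := Nat.cast_nonneg n
    have hint : IntegrableOn (fun t => -deriv h t) (Ioc 0 (n : ℝ)) :=
      ((intervalIntegrable_iff_integrableOn_Ioc_of_le hn).1
        (hac n hn).intervalIntegrable_deriv).neg
    have hnn : 0 ≤ᵐ[volume.restrict (Ioc 0 (n : ℝ))] fun t => -deriv h t := by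
      rw [EventuallyLE, ae_restrict_iff' measurableSet_Ioc]
      filter_upwards [hd] with t ht htm
      have := ht htm.1
      simp only [Pi.zero_apply]
      linarith
    have hmk := mul_meas_ge_le_integral_of_nonneg hnn hint c
    have hval : ∫ t in Ioc 0 (n : ℝ), -deriv h t = h 0 - h n := by
      rw [integral_neg, ← intervalIntegral.integral_of_le hn, (hac n hn).integral_deriv_eq_sub]
      ring
    rw [hval, measureReal_def, Measure.restrict_apply hmeas] at hmk
    have hfin : volume ({t : ℝ | c ≤ -deriv h t} ∩ Ioc 0 (n : ℝ)) ≠ ⊤ :=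
      ((measure_mono inter_subset_right).trans_lt measure_Ioc_lt_top).ne
    rw [← ENNReal.ofReal_toReal hfin]
    refine ENNReal.ofReal_le_ofReal ?_
    rw [le_div_iff₀ hc]
    have := h0 n
    linarith
  have hsub : {t : ℝ | 0 < t ∧ c ≤ -deriv h t}
      ⊆ ⋃ n : ℕ, {t : ℝ | c ≤ -deriv h t} ∩ Ioc 0 (n : ℝ) := by
    rintro t ⟨ht, htc⟩
    obtain ⟨n, hn⟩ := exists_nat_ge t
    exact mem_iUnion.2 ⟨n, htc, ht, hn⟩
  refine (measure_mono hsub).trans_lt ?_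
  have hmono : Monotone fun n : ℕ => {t : ℝ | c ≤ -deriv h t} ∩ Ioc 0 (n : ℝ) := fun m n hmn =>
    inter_subset_inter_right _ (Ioc_subset_Ioc_right (Nat.cast_le.2 hmn))
  rw [hmono.measure_iUnion]
  exact (iSup_le hbound).trans_lt ENNReal.ofReal_lt_top

/-- Almost every point of a set of reals is a left accumulation point of it. -/
theorem ae_neBot_nhdsWithin_inter_Iio (S : Set ℝ) :
    ∀ᵐ t : ℝ, t ∈ S → (𝓝[S ∩ Iio t] t).NeBot := by
  have h := (countable_setOfPred_isolated_left_within (s := S)).ae_notMem volume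
  filter_upwards [h] with t ht htS
  exact ⟨fun hbot => ht ⟨htS, hbot⟩⟩

/-- If `W + K V` does not increase as long as `W < ρ`, where `V` is nonincreasing and nonnegative,
and if `W` is frequently small, then `W` tends to zero. -/
theorem tendsto_zero_of_add_mul_le {V W : ℝ → ℝ} {K ρ : ℝ} (hK : 0 ≤ K) (hρ : 0 < ρ)
    (hV : AntitoneOn V (Ici 0)) (hV0 : ∀ t, 0 ≤ V t) (hW0 : ∀ t, 0 ≤ W t)
    (hWc : ContinuousOn W (Ici 0))
    (hfreq : ∀ ε > 0, ∃ᶠ t in atTop, W t < ε)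
    (hVW : ∀ s t, 0 ≤ s → s ≤ t → (∀ u ∈ Ioo s t, W u < ρ) → W t + K * V t ≤ W s + K * V s) :
    Tendsto W atTop (𝓝 0) := by
  have hsmall : ∀ ε > 0, ∃ s₀, 0 ≤ s₀ ∧ ∀ s t, s₀ ≤ s → s ≤ t → K * V s - K * V t < ε := by
    intro ε hε
    have hne : (V '' Ici 0).Nonempty := ⟨V 0, 0, self_mem_Ici, rfl⟩
    have hbdd : BddBelow (V '' Ici 0) := ⟨0, by rintro _ ⟨t, -, rfl⟩; exact hV0 t⟩
    -- Dividing by `K + 1` rather than `K` covers `K = 0`.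
    obtain ⟨_, ⟨s₀, hs₀, rfl⟩, hlt⟩ := exists_lt_of_csInf_lt hne
      (lt_add_of_pos_right (sInf (V '' Ici 0)) (show 0 < ε / (K + 1) by positivity))
    refine ⟨s₀, hs₀, fun s t hs hst => ?_⟩
    have h0s : (0 : ℝ) ≤ s := le_trans hs₀ hs
    have h1 := hV hs₀ h0s hs
    have h2 : sInf (V '' Ici 0) ≤ V t := csInf_le hbdd ⟨t, h0s.trans hst, rfl⟩
    have h3 : V s - V t < ε / (K + 1) := by linarith
    rw [lt_div_iff₀ (by positivity)] at h3
    have h4 := hV h0s (h0s.trans hst : (0 : ℝ) ≤ t) hst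
    nlinarith
  rw [Metric.tendsto_atTop]
  intro ε hε
  set δ := min ε ρ with hδ
  have hδ0 : 0 < δ := lt_min hε hρ
  obtain ⟨s₀, hs₀, hKV⟩ := hsmall (δ / 2) (by positivity)
  obtain ⟨s, hs, hWs⟩ := frequently_atTop.1 (hfreq (δ / 2) (by positivity)) s₀
  have h0s : (0 : ℝ) ≤ s := hs₀.trans hs
  have key : ∀ t, s ≤ t → W t < δ := by
    by_contra! hex
    -- `sInf B` is the first time at which `W` reaches `δ`; before it `W < δ ≤ ρ`, so `hVW` applies.
    set B := Ici s ∩ W ⁻¹' Ici δ with hB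
    have hBne : B.Nonempty := hex
    have hBc : IsClosed B :=
      (hWc.mono (Ici_subset_Ici.2 h0s)).preimage_isClosed_of_isClosed isClosed_Ici isClosed_Ici
    have hBb : BddBelow B := ⟨s, fun t ht => ht.1⟩
    have hmem := hBc.csInf_mem hBne hBb
    have hlt : ∀ u ∈ Ioo s (sInf B), W u < ρ := fun u hu => by
      by_contra! hge
      exact (notMem_of_lt_csInf hu.2 hBb) ⟨hu.1.le, (min_le_right _ _).trans hge⟩
    have h1 := hVW s (sInf B) h0s hmem.1 hlt
    have h2 := hKV s (sInf B) hs hmem.1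
    have h3 : δ ≤ W (sInf B) := hmem.2
    linarith
  refine ⟨s, fun t ht => ?_⟩
  rw [Real.dist_eq, sub_zero, abs_of_nonneg (hW0 t)]
  exact (key t ht).trans_le (min_le_left _ _)

namespace SwitchingGradientFlow

variable {n : ℕ}

/-! ### Convex analysis of a single mode -/

/-- A real-valued convex function on `ℝⁿ` is continuous. -/
theorem continuous_of_convexOn_univ {g : E n → ℝ} (hg : ConvexOn ℝ univ g) : Continuous g :=
  continuousOn_univ.1 (hg.continuousOn isOpen_univ)

/-- Subgradients of a real-valued convex function on `ℝⁿ` are bounded on bounded sets. -/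
theorem exists_norm_subgradient_le {g : E n → ℝ} (hg : ConvexOn ℝ univ g) (R : ℝ) :
    ∃ K, ∀ x, ‖x‖ ≤ R → ∀ s ∈ subdifferential g x, ‖s‖ ≤ K := by
  obtain ⟨K, hK⟩ := (isCompact_closedBall (0 : E n) (R + 1)).exists_bound_of_continuousOn
    (continuous_of_convexOn_univ hg).continuousOn
  have hK' : ∀ x : E n, ‖x‖ ≤ R + 1 → |g x| ≤ K := fun x hx => hK x (by simpa using hx)
  refine ⟨2 * K, fun x hx s hs => ?_⟩
  by_cases h0 : s = 0
  · subst h0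
    have := (abs_nonneg _).trans (hK' x (by linarith))
    simpa using this
  have hn : 0 < ‖s‖ := norm_pos_iff.2 h0
  -- A unit step along `s` raises `g` by at least `‖s‖`.
  have h1 := hs (x + ‖s‖⁻¹ • s)
  rw [add_sub_cancel_left, real_inner_smul_right, real_inner_self_eq_norm_sq] at h1
  have h2 : ‖s‖⁻¹ * ‖s‖ ^ 2 = ‖s‖ := by field_simp
  have h3 : ‖x + ‖s‖⁻¹ • s‖ ≤ R + 1 := by
    refine (norm_add_le _ _).trans (add_le_add hx ?_)
    rw [norm_smul, norm_inv, norm_norm, inv_mul_cancel₀ hn.ne']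
  have h4 := (abs_le.1 (hK' _ h3)).2
  have h5 := (abs_le.1 (hK' x (by linarith))).1
  linarith

theorem inner_flowMap_le {g : E n → ℝ} {D : Set (E n)} {x y a : E n} (hy : y ∈ flowMap g D x)
    (ha : a ∈ D) : ⟪y, a - x⟫ ≤ g a - g x := by
  obtain ⟨s, hs, w, hw, rfl⟩ := hy
  have h1 := hs a
  have h2 := hw.2 a ha
  rw [inner_add_left]
  linarith

theorem mem_of_mem_flowMap {g : E n → ℝ} {D : Set (E n)} {x y : E n} (hy : y ∈ flowMap g D x) :
    x ∈ D := by
  obtain ⟨s, hs, w, hw, rfl⟩ := hy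
  exact hw.1

/-- If a curve with velocity `-(s + w)` has visited `D` immediately before, where `w` is normal to
`D`, then its speed is at most `‖s‖`. -/
theorem norm_velocity_le {φ : ℝ → E n} {t : ℝ} {S : Set ℝ} {D : Set (E n)} {s w : E n}
    (hφ : HasDerivAt φ (-(s + w)) t) (hS : (𝓝[S ∩ Iio t] t).NeBot) (hSD : ∀ u ∈ S, φ u ∈ D)
    (hw : w ∈ normalCone D (φ t)) : ‖-(s + w)‖ ≤ ‖s‖ := by
  have hslope : Tendsto (fun u => ⟪w, slope φ t u⟫) (𝓝[S ∩ Iio t] t) (𝓝 ⟪w, -(s + w)⟫) := by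
    have h := (hasDerivAt_iff_tendsto_slope.1 hφ).mono_left
      (nhdsWithin_mono t (s := S ∩ Iio t) fun u hu => (ne_of_lt hu.2))
    exact tendsto_const_nhds.inner h
  -- Left difference quotients point out of `D`, as `u - t < 0` reverses the normal cone inequality.
  -- The normal part thus cannot add to the speed.
  have hnn : 0 ≤ ⟪w, -(s + w)⟫ := by
    refine ge_of_tendsto hslope ?_
    filter_upwards [self_mem_nhdsWithin] with u hu
    have h1 := hw.2 (φ u) (hSD u hu.1)
    have h2 : u - t < 0 := sub_neg.2 hu.2
    rw [slope_def_module, real_inner_smul_right]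
    exact mul_nonneg_of_nonpos_of_nonpos (inv_nonpos.2 h2.le) h1
  set v := -(s + w) with hv
  have hvv : ⟪v, v⟫ = -⟪s, v⟫ - ⟪w, v⟫ := by
    conv_lhs => rw [hv, inner_neg_left, inner_add_left]
    ring
  rw [real_inner_self_eq_norm_sq] at hvv
  have hcs := (abs_le.1 (abs_real_inner_le_norm s v)).1
  have h0 := norm_nonneg v
  by_contra! hlt
  nlinarith [norm_nonneg s]

/-- Near a point that is not a minimizer, the values on `D` stay away from the minimum. -/
theorem eventually_le_sub_of_notMem_argminOn {g : E n → ℝ} {D : Set (E n)} (hg : Continuous g)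
    (hD : IsClosed D) {a x₀ : E n} (ha : a ∈ argminOn g D) (hx₀ : x₀ ∉ argminOn g D) :
    ∀ᶠ c in 𝓝[>] (0 : ℝ), ∀ᶠ x in 𝓝 x₀, x ∈ D → c ≤ g x - g a := by
  by_cases hxD : x₀ ∈ D
  · have hlt : 0 < g x₀ - g a := by
      by_contra! hle
      exact hx₀ ⟨hxD, fun y hy => by linarith [ha.2 y hy]⟩
    filter_upwards [Ioo_mem_nhdsGT hlt] with c hc
    have hcont : ContinuousAt (fun x => g x - g a) x₀ := by fun_prop
    filter_upwards [hcont.eventually (lt_mem_nhds hc.2)] with x hx _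
    exact hx.le
  -- Points near `x₀` miss the closed set `D`, so any `c` works.
  · refine Eventually.of_forall fun c => ?_
    filter_upwards [hD.isOpen_compl.mem_nhds hxD] with x hx hxD'
    exact absurd hxD' hx

theorem deriv_norm_sub_sq {φ : ℝ → E n} {v : E n} {t : ℝ} (hφ : HasDerivAt φ v t) (x : E n) :
    deriv (fun u => ‖φ u - x‖ ^ 2) t = 2 * ⟪v, φ t - x⟫ := by
  rw [(hφ.sub_const x).norm_sq.deriv, real_inner_comm]

variable {p : ℕ} {f : Fin p → E n → ℝ} {C : Fin p → Set (E n)} {σ : ℝ → Fin p} {φ : ℝ → E n}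

/-! ### Estimates along solutions -/

theorem IsCompleteSolution.ae_hasDerivAt (hφ : IsCompleteSolution f C σ φ) :
    ∀ᵐ t : ℝ, 0 < t → ∃ v, HasDerivAt φ v t ∧ -v ∈ flowMap (f (σ t)) (C (σ t)) (φ t) := by
  filter_upwards [(ae_restrict_iff' measurableSet_Ici).1 hφ.2.2] with t ht h0
  obtain ⟨v, hv, hvm⟩ := ht h0.le
  exact ⟨v, hv.hasDerivAt (Ici_mem_nhds h0), hvm⟩

theorem IsCompleteSolution.absolutelyContinuousOnInterval (hφ : IsCompleteSolution f C σ φ)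
    {s t : ℝ} (hs : 0 ≤ s) (hst : s ≤ t) : AbsolutelyContinuousOnInterval φ s t :=
  hφ.2.1 s hs t (hs.trans hst) hst

theorem IsCompleteSolution.ae_deriv_norm_sub_sq_le (hφ : IsCompleteSolution f C σ φ) {a : E n}
    (ha : a ∈ commonMinimizers f C) :
    ∀ᵐ t : ℝ, 0 < t → φ t ∈ C (σ t) ∧
      deriv (fun u => ‖φ u - a‖ ^ 2) t ≤ -(2 * (f (σ t) (φ t) - f (σ t) a)) := by
  filter_upwards [hφ.ae_hasDerivAt] with t ht h0
  obtain ⟨v, hv, hvm⟩ := ht h0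
  refine ⟨mem_of_mem_flowMap hvm, ?_⟩
  have h1 := inner_flowMap_le hvm (mem_iInter.1 ha (σ t)).1
  rw [deriv_norm_sub_sq hv, ← neg_sub a (φ t), inner_neg_right, ← inner_neg_left]
  linarith

theorem IsCompleteSolution.ae_deriv_norm_sub_sq_nonpos (hφ : IsCompleteSolution f C σ φ) {a : E n}
    (ha : a ∈ commonMinimizers f C) :
    ∀ᵐ t : ℝ, 0 < t → deriv (fun u => ‖φ u - a‖ ^ 2) t ≤ 0 := by
  filter_upwards [hφ.ae_deriv_norm_sub_sq_le ha] with t ht h0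
  obtain ⟨hmem, hle⟩ := ht h0
  have := (mem_iInter.1 ha (σ t)).2 _ hmem
  linarith

/-- The distance to a common minimizer does not increase along solutions. -/
theorem IsCompleteSolution.antitoneOn_norm_sub_sq (hφ : IsCompleteSolution f C σ φ) {a : E n}
    (ha : a ∈ commonMinimizers f C) : AntitoneOn (fun t => ‖φ t - a‖ ^ 2) (Ici 0) := by
  intro s hs t _ hst
  refine ((hφ.absolutelyContinuousOnInterval hs hst).norm_sub_sq a).le_of_ae_deriv_nonpos hst ?_
  filter_upwards [hφ.ae_deriv_norm_sub_sq_nonpos ha] with u hu hmem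
  exact hu (lt_of_le_of_lt hs hmem.1)

theorem IsCompleteSolution.exists_norm_le (hφ : IsCompleteSolution f C σ φ)
    (hA : (commonMinimizers f C).Nonempty) : ∃ R, ∀ t, 0 ≤ t → ‖φ t‖ ≤ R := by
  obtain ⟨a, ha⟩ := hA
  refine ⟨‖φ 0 - a‖ + ‖a‖, fun t ht => ?_⟩
  have h1 : ‖φ t - a‖ ^ 2 ≤ ‖φ 0 - a‖ ^ 2 := hφ.antitoneOn_norm_sub_sq ha self_mem_Ici ht ht
  have h2 := le_of_sq_le_sq h1 (norm_nonneg _)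
  have h3 := norm_add_le (φ t - a) a
  rw [sub_add_cancel] at h3
  linarith

/-- Solutions have essentially bounded velocity. -/
theorem IsCompleteSolution.exists_ae_norm_velocity_le (hφ : IsCompleteSolution f C σ φ)
    (hf : ∀ q, ConvexOn ℝ univ (f q)) (hA : (commonMinimizers f C).Nonempty) :
    ∃ L, 0 ≤ L ∧ ∀ᵐ t : ℝ, 0 < t →
      ∃ v, HasDerivAt φ v t ∧ -v ∈ flowMap (f (σ t)) (C (σ t)) (φ t) ∧ ‖v‖ ≤ L := by
  obtain ⟨R, hR⟩ := hφ.exists_norm_le hA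
  choose K hK using fun q => exists_norm_subgradient_le (hf q) R
  refine ⟨∑ q, |K q|, Finset.sum_nonneg fun q _ => abs_nonneg _, ?_⟩
  -- Almost every time is a limit of earlier times in the same mode with `φ` in its constraint set.
  have hacc := ae_all_iff.2 fun q =>
    ae_neBot_nhdsWithin_inter_Iio {t : ℝ | σ t = q ∧ φ t ∈ C q}
  filter_upwards [hφ.ae_hasDerivAt, hacc] with t ht hta h0
  obtain ⟨v, hv, hvm⟩ := ht h0
  refine ⟨v, hv, hvm, ?_⟩
  have hmem := mem_of_mem_flowMap hvm
  obtain ⟨s, hs, w, hw, hsw⟩ := hvm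
  obtain rfl : v = -(s + w) := by rw [← neg_neg v, ← hsw]
  have h1 := norm_velocity_le hv (hta (σ t) ⟨rfl, hmem⟩) (fun u hu => hu.2) hw
  refine h1.trans ((hK (σ t) _ (hR t h0.le) s hs).trans ((le_abs_self _).trans ?_))
  exact Finset.single_le_sum (f := fun q => |K q|) (fun q _ => abs_nonneg _) (Finset.mem_univ _)

/-! ### Convergence and location of the limit -/

/-- Around every point, modes not minimized there decrease the distance to a common minimizer at a
uniform rate. -/
theorem exists_uniform_gap (hf : ∀ q, ConvexOn ℝ univ (f q)) (hC : ∀ q, IsClosed (C q))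
    {a : E n} (ha : a ∈ commonMinimizers f C) (x₀ : E n) :
    ∃ c > 0, ∃ r > 0, ∀ x, ‖x - x₀‖ < r → ∀ q, x₀ ∉ argminOn (f q) (C q) → x ∈ C q →
      c ≤ f q x - f q a := by
  have h : ∀ᶠ c in 𝓝[>] (0 : ℝ), ∀ q, ∀ᶠ x in 𝓝 x₀,
      x₀ ∉ argminOn (f q) (C q) → x ∈ C q → c ≤ f q x - f q a := by
    refine eventually_all.2 fun q => ?_
    by_cases hq : x₀ ∈ argminOn (f q) (C q)
    · exact Eventually.of_forall fun c => Eventually.of_forall fun x hx => absurd hq hx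
    · filter_upwards [eventually_le_sub_of_notMem_argminOn (continuous_of_convexOn_univ (hf q))
        (hC q) (mem_iInter.1 ha q) hq] with c hc
      filter_upwards [hc] with x hx _
      exact hx
  obtain ⟨c, hc, hc0⟩ := (h.and self_mem_nhdsWithin).exists
  obtain ⟨r, hr, hball⟩ := Metric.eventually_nhds_iff.1 (eventually_all.2 hc)
  exact ⟨c, hc0, r, hr, fun x hx q => hball (by rwa [dist_eq_norm]) q⟩

/-- A solution converges to each of its cluster points. -/
theorem IsCompleteSolution.tendsto_of_mapClusterPt (hφ : IsCompleteSolution f C σ φ)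
    (hf : ∀ q, ConvexOn ℝ univ (f q)) (hC : ∀ q, IsClosed (C q))
    (hA : (commonMinimizers f C).Nonempty) {x₀ : E n} (hx₀ : MapClusterPt x₀ atTop φ) :
    Tendsto φ atTop (𝓝 x₀) := by
  obtain ⟨L, hL0, hL⟩ := hφ.exists_ae_norm_velocity_le hf hA
  obtain ⟨a, ha⟩ := hA
  obtain ⟨c, hc, r, hr, hgap⟩ := exists_uniform_gap hf hC ha x₀
  have hW : Tendsto (fun t => ‖φ t - x₀‖ ^ 2) atTop (𝓝 0) := by
    -- `W` grows at rate at most `2 L r` in the `r`-ball, and `V` falls at rate at least `2 c` in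
    -- modes not minimized at `x₀`; `K = L r / c` balances the two.
    refine tendsto_zero_of_add_mul_le (V := fun t => ‖φ t - a‖ ^ 2) (K := L * r / c) (ρ := r ^ 2)
      (by positivity) (by positivity) (hφ.antitoneOn_norm_sub_sq ha) (fun t => by positivity)
      (fun t => by positivity) ?_ ?_ ?_
    · intro t ht
      have ht' : (0 : ℝ) ≤ t + 1 := by linarith [mem_Ici.1 ht]
      have h := (((hφ.absolutelyContinuousOnInterval le_rfl ht').norm_sub_sq x₀).continuousOn)
      rw [uIcc_of_le ht'] at h
      refine (h t ⟨ht, by linarith⟩).mono_of_mem_nhdsWithin ?_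
      rw [← Ici_inter_Iic]
      exact inter_mem self_mem_nhdsWithin
        (mem_nhdsWithin_of_mem_nhds (Iic_mem_nhds (by linarith)))
    · intro ε hε
      have hcont : ContinuousAt (fun x : E n => ‖x - x₀‖ ^ 2) x₀ := by fun_prop
      exact hx₀.frequently (hcont.eventually (gt_mem_nhds (by simpa using hε)))
    · intro s t hs hst hlt
      have hφac := hφ.absolutelyContinuousOnInterval hs hst
      refine ((hφac.norm_sub_sq x₀).fun_add
        ((hφac.norm_sub_sq a).const_mul (L * r / c))).le_of_ae_deriv_nonpos hst ?_
      filter_upwards [hL, hφ.ae_deriv_norm_sub_sq_le ha] with u hu hua hmem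
      have h0u : 0 < u := lt_of_le_of_lt hs hmem.1
      obtain ⟨v, hv, hvm, hvL⟩ := hu h0u
      obtain ⟨huC, hVle⟩ := hua h0u
      have hur : ‖φ u - x₀‖ < r := lt_of_pow_lt_pow_left₀ 2 hr.le (hlt u hmem)
      rw [deriv_fun_add (hv.sub_const x₀).norm_sq.differentiableAt
        ((hv.sub_const a).norm_sq.differentiableAt.const_mul _),
        deriv_const_mul _ (hv.sub_const a).norm_sq.differentiableAt]
      set V' := deriv (fun u => ‖φ u - a‖ ^ 2) u
      have hV0 : V' ≤ 0 := by
        have := (mem_iInter.1 ha (σ u)).2 _ huC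
        linarith
      have hKnn : 0 ≤ L * r / c := by positivity
      rw [deriv_norm_sub_sq hv]
      by_cases hq : x₀ ∈ argminOn (f (σ u)) (C (σ u))
      · have h1 := inner_flowMap_le hvm hq.1
        have h2 := hq.2 _ huC
        rw [inner_neg_left, ← inner_neg_right, neg_sub] at h1
        nlinarith
      · have h1 := hgap _ hur (σ u) hq huC
        have h2 := real_inner_le_norm v (φ u - x₀)
        have h3 : ‖v‖ * ‖φ u - x₀‖ ≤ L * r := by gcongr
        have h4 : L * r / c * V' ≤ L * r / c * -(2 * c) := by gcongr; linarith
        have h5 : L * r / c * -(2 * c) = -(2 * (L * r)) := by field_simp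
        linarith
  rw [tendsto_iff_norm_sub_tendsto_zero]
  simpa using hW.sqrt

/-- The limit of a solution minimizes every mode that is active for infinite total time. -/
theorem IsCompleteSolution.mem_asymptoticMinimizers (hφ : IsCompleteSolution f C σ φ)
    (hf : ∀ q, ConvexOn ℝ univ (f q)) (hC : ∀ q, IsClosed (C q))
    (hA : (commonMinimizers f C).Nonempty) {x₀ : E n} (hlim : Tendsto φ atTop (𝓝 x₀)) :
    x₀ ∈ asymptoticMinimizers f C σ := by
  refine mem_iInter₂.2 fun q hq => ?_
  by_contra hx₀
  obtain ⟨a, ha⟩ := hA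
  obtain ⟨c, hc, r, hr, hgap⟩ := exists_uniform_gap hf hC ha x₀
  obtain ⟨s, hs⟩ := ((eventually_ge_atTop 0).and (hlim.eventually (Metric.ball_mem_nhds x₀ hr))).exists_forall_of_atTop
  have hs0 : 0 ≤ s := (hs s le_rfl).1
  have hfin := volume_setOf_le_neg_deriv_lt_top
    (fun T hT => (hφ.absolutelyContinuousOnInterval le_rfl hT).norm_sub_sq a)
    (hφ.ae_deriv_norm_sub_sq_nonpos ha) (fun t => by positivity)
    (show 0 < 2 * c by positivity)
  have hsub : activeTimes σ q ≤ᵐ[volume] (Icc 0 s ∪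
      {t | 0 < t ∧ 2 * c ≤ -deriv (fun u => ‖φ u - a‖ ^ 2) t} : Set ℝ) := by
    filter_upwards [hφ.ae_deriv_norm_sub_sq_le ha] with t ht htq
    obtain ⟨h0, rfl⟩ := htq
    by_cases hts : t ≤ s
    · exact Or.inl ⟨h0, hts⟩
    have hst : s < t := not_le.1 hts
    have hpos : 0 < t := lt_of_le_of_lt hs0 hst
    obtain ⟨htC, hle⟩ := ht hpos
    have h1 := hgap _ (by simpa [dist_eq_norm] using (hs t hst.le).2) (σ t) hx₀ htC
    exact Or.inr ⟨hpos, by linarith⟩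
  have htop : volume (activeTimes σ q) = ⊤ := hq
  refine absurd htop (((measure_mono_ae hsub).trans (measure_union_le _ _)).trans_lt ?_).ne
  exact ENNReal.add_lt_top.2 ⟨measure_Icc_lt_top, hfin⟩

end SwitchingGradientFlow

theorem corollary1 {n p : ℕ}
    (f : Fin p → SwitchingGradientFlow.E n → ℝ) (C : Fin p → Set (SwitchingGradientFlow.E n))
    (hf : ∀ q, ConvexOn ℝ Set.univ (f q))
    (hC_nonempty : ∀ q, (C q).Nonempty)
    (hC_closed : ∀ q, IsClosed (C q))
    (hC_convex : ∀ q, Convex ℝ (C q))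
    (hA : (SwitchingGradientFlow.commonMinimizers f C).Nonempty)
    (σ : ℝ → Fin p) (hσ : SwitchingGradientFlow.IsSwitchingSignal σ)
    (φ : ℝ → SwitchingGradientFlow.E n)
    (hφ : SwitchingGradientFlow.IsCompleteSolution f C σ φ) :
    ∃ a ∈ SwitchingGradientFlow.asymptoticMinimizers f C σ, Tendsto φ atTop (𝓝 a) := by
  obtain ⟨R, hR⟩ := hφ.exists_norm_le hA
  have hmem : ∀ᶠ t in atTop, φ t ∈ Metric.closedBall (0 : SwitchingGradientFlow.E n) R := by
    filter_upwards [eventually_ge_atTop 0] with t ht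
    simpa using hR t ht
  obtain ⟨x₀, -, hx₀⟩ := (isCompact_closedBall (0 : SwitchingGradientFlow.E n)
    R).exists_mapClusterPt_of_frequently hmem.frequently
  have hlim := hφ.tendsto_of_mapClusterPt hf hC_closed hA hx₀
  exact ⟨x₀, hφ.mem_asymptoticMinimizers hf hC_closed hA hlim, hlim⟩
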